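/- Let $\mathcal V$ be a closed symmetric monoidal model category. Left semimodel categories are understood in the sense of Spitzweck: a bicomplete category with classes of weak equivalences, cofibrations and fibrations satisfying the model category axioms (with fibrations stable under base change), except that acyclic cofibrations are only required to lift against fibrations if their domain is cofibrant, and factorizations (acyclic cofibration, fibration) are only required for maps with cofibrant domain. A left $\mathcal V$-semimodel category is a tensored and cotensored $\mathcal V$-category with a left semimodel structure that satisfies the pushout-product axiom (for cofibrations with cofibrant domain) and the unit axiom. It is tractable if it is cofibrantly generated by sets of maps with cofibrant domains. Let $\mathcal M$, $\mathcal N$ and $\mathcal N'$ be tractable left $\mathcal V$-semimodel categories and let $S$ be a set of maps in $\mathcal M$. A fibrant object $Z$ of $\mathcal M$ is $S$-local if every $f\colon A\to B$ in $S$ induces a weak equivalence $\mathbb R\underline{\mathrm{Hom}}(B,Z)\to\mathbb R\underline{\mathrm{Hom}}(A,Z)$ of derived mapping objects in $\mathcal V$; an $S$-local equivalence is a map inducing such weak equivalences for all fibrant $S$-local $Z$. Assume that the $\mathcal V$-enriched left Bousfield localization $L_S\mathcal M$ exists as a tractable left $\mathcal V$-semimodel category, i.e. that the $\mathcal V$-category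 underlying $\mathcal M$ carries such a structure with the cofibrations of $\mathcal M$ as cofibrations and the $S$-local equivalences as weak equivalences. Let $U\colon\mathcal N\to\mathcal M$ and $U'\colon\mathcal M\to\mathcal N'$ be right $\mathcal V$-adjoint functors, with left $\mathcal V$-adjoints $F$ and $F'$. A $\mathcal V$-adjunction is a Quillen pair if its right adjoint preserves fibrations and acyclic fibrations. Then: (a) $F\colon L_S\mathcal M\rightleftarrows\mathcal N:\!U$ is a Quillen pair if and only if $U$ (as a functor $\mathcal N\to\mathcal M$) preserves acyclic fibrations and sends fibrant objects to fibrant $S$-local objects. (b) $F'\colon\mathcal N'\rightleftarrows L_S\mathcal M:\!U'$ is a Quillen pair if and only if $U'$ (as a functor $\mathcal M\to\mathcal N'$) preserves acyclic fibrations and sends fibrant $S$-local objects to fibrant objects. -/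

import Mathlib

open CategoryTheory Category MonoidalCategory Limits HomotopicalAlgebra

universe v u u₁ u₂ u₃

namespace EnrichedSemimodel

/-! ### The base of enrichment: closed symmetric monoidal model categories -/

section Base

variable {V : Type u} [Category.{v} V] [MonoidalCategory V] [ModelCategory V]

/-- The pushout-product `i □ j : L ⊗ A ⨿_{K ⊗ A} K ⊗ B ⟶ L ⊗ B` of `i : K ⟶ L` and
`j : A ⟶ B`. -/
noncomputable def pushoutProduct {K L A B : V} (i : K ⟶ L) (j : A ⟶ B) :
    pushout (i ▷ A) (K ◁ j) ⟶ L ⊗ B :=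
  pushout.desc (L ◁ j) (i ▷ B) (whisker_exchange i j).symm

variable (V) in
/-- The compatibility between the model structure and the (closed symmetric) monoidal structure:
the pushout-product axiom and the unit axiom. -/
class IsMonoidalModelCategory : Prop where
  cofibration_pushoutProduct {K L A B : V} (i : K ⟶ L) (j : A ⟶ B) :
    cofibrations V i → cofibrations V j → cofibrations V (pushoutProduct i j)
  weakEquivalence_pushoutProduct {K L A B : V} (i : K ⟶ L) (j : A ⟶ B) :
    cofibrations V i → cofibrations V j → (weakEquivalences V i ∨ weakEquivalences V j) →
      weakEquivalences V (pushoutProduct i j)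
  unit {Q : V} (q : Q ⟶ 𝟙_ V) (X : V) : IsCofibrant Q → weakEquivalences V q → IsCofibrant X →
    weakEquivalences V (q ▷ X ≫ (λ_ X).hom)

end Base

/-! ### Left semimodel categories -/

section Semimodel

variable (M : Type u₁) [Category.{v} M] [HasLimits M] [HasColimits M]

/-- A (Spitzweck) left semimodel structure on a bicomplete category. Compared with a model
structure, acyclic cofibrations are only required to lift against fibrations when their domain is
cofibrant, and (acyclic cofibration, fibration)-factorizations are only required for maps with
cofibrant domain. -/
structure LeftSemimodelStructure where
  /-- the weak equivalences -/
  W : MorphismProperty M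
  /-- the cofibrations -/
  Cof : MorphismProperty M
  /-- the fibrations -/
  Fib : MorphismProperty M
  twoOutOfThree : W.HasTwoOutOfThreeProperty
  retract_W : W.IsStableUnderRetracts
  retract_Cof : Cof.IsStableUnderRetracts
  retract_Fib : Fib.IsStableUnderRetracts
  baseChange_Fib : Fib.IsStableUnderBaseChange
  lift_cof_acyclicFib {A B X Y : M} (i : A ⟶ B) (p : X ⟶ Y) :
    Cof i → Fib p → W p → HasLiftingProperty i p
  lift_acyclicCof_fib {A B X Y : M} (i : A ⟶ B) (p : X ⟶ Y) :
    Cof (initial.to A) → Cof i → W i → Fib p → HasLiftingProperty i p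
  factor_cof_acyclicFib {X Y : M} (f : X ⟶ Y) :
    ∃ (Z : M) (i : X ⟶ Z) (p : Z ⟶ Y), Cof i ∧ Fib p ∧ W p ∧ i ≫ p = f
  factor_acyclicCof_fib {X Y : M} (f : X ⟶ Y) : Cof (initial.to X) →
    ∃ (Z : M) (i : X ⟶ Z) (p : Z ⟶ Y), Cof i ∧ W i ∧ Fib p ∧ i ≫ p = f

namespace LeftSemimodelStructure

variable {M} (A : LeftSemimodelStructure M)

/-- The acyclic fibrations. -/
def AFib : MorphismProperty M := A.Fib ⊓ A.W

/-- Cofibrant objects. -/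
def IsCofibrant (X : M) : Prop := A.Cof (initial.to X)

/-- Fibrant objects. -/
def IsFibrant (X : M) : Prop := A.Fib (terminal.from X)

end LeftSemimodelStructure

variable {M}

/-- Relative cell complexes: transfinite compositions of pushouts of coproducts of maps in `I`. -/
def cell (I : MorphismProperty M) : MorphismProperty M :=
  MorphismProperty.transfiniteCompositions.{v} (MorphismProperty.coproducts.{v} I).pushouts

/-- `X` is small relative to `D`: there is a cardinal `κ` such that `Hom(X, -)` commutes with the
colimit of every `μ`-sequence of maps in `D`, for every regular cardinal `μ ≥ κ`. -/
def IsSmallRelativeTo (D : MorphismProperty M) (X : M) : Prop :=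
  ∃ κ : Cardinal.{v}, ∀ (μ : Cardinal.{v}) [Fact μ.IsRegular] [OrderBot μ.ord.ToType]
    [SuccOrder μ.ord.ToType], κ ≤ μ →
    ∀ {Y Y' : M} (f : Y ⟶ Y') (h : D.TransfiniteCompositionOfShape μ.ord.ToType f),
      PreservesColimit h.F (coyoneda.obj (Opposite.op X))

/-- A left semimodel structure is tractable if it is cofibrantly generated by (small) sets `I`
and `J` of maps with cofibrant domains. As usual for left semimodel structures, the domains of the
maps in `J` are only required to be small relative to `J`-cell complexes with cofibrant domain. -/
def LeftSemimodelStructure.IsTractable (A : LeftSemimodelStructure M) : Prop :=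
  ∃ I J : MorphismProperty M,
    MorphismProperty.IsSmall.{v} I ∧ MorphismProperty.IsSmall.{v} J ∧
    A.AFib = I.rlp ∧ A.Fib = J.rlp ∧
    (∀ ⦃X Y : M⦄ (i : X ⟶ Y), I i → A.IsCofibrant X ∧ IsSmallRelativeTo (cell I) X) ∧
    (∀ ⦃X Y : M⦄ (j : X ⟶ Y), J j → A.IsCofibrant X ∧
      IsSmallRelativeTo (fun X' _ f ↦ cell J f ∧ A.IsCofibrant X') X)

end Semimodel

/-! ### Enriched left semimodel categories -/

section Enriched

variable (V : Type u) [Category.{v} V] [MonoidalCategory V] [SymmetricCategory V]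
  [MonoidalClosed V] [ModelCategory V]
variable {M : Type u₁} [Category.{v} M] [EnrichedOrdinaryCategory V M]

/-- The comparison `T ⟶[V] Y` to `[K, X ⟶[V] Y]` induced by a map `η : K ⟶ (X ⟶[V] T)`. -/
noncomputable def tensorComparison {K : V} {X T : M} (η : K ⟶ (X ⟶[V] T)) (Y : M) :
    (T ⟶[V] Y) ⟶ (ihom K).obj (X ⟶[V] Y) :=
  MonoidalClosed.curry (η ▷ (T ⟶[V] Y) ≫ eComp V X T Y)

/-- `η : K ⟶ (X ⟶[V] T)` exhibits `T` as the tensor `K ⊗ X`. -/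
def IsTensor {K : V} {X T : M} (η : K ⟶ (X ⟶[V] T)) : Prop :=
  ∀ Y : M, IsIso (tensorComparison V η Y)

/-- The comparison `X ⟶[V] C` to `[K, X ⟶[V] Y]` induced by a map `ε : K ⟶ (C ⟶[V] Y)`. -/
noncomputable def cotensorComparison {K : V} {C Y : M} (ε : K ⟶ (C ⟶[V] Y)) (X : M) :
    (X ⟶[V] C) ⟶ (ihom K).obj (X ⟶[V] Y) :=
  MonoidalClosed.curry ((β_ K (X ⟶[V] C)).hom ≫ (X ⟶[V] C) ◁ ε ≫ eComp V X C Y)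

/-- `ε : K ⟶ (C ⟶[V] Y)` exhibits `C` as the cotensor `Y ^ K`. -/
def IsCotensor {K : V} {C Y : M} (ε : K ⟶ (C ⟶[V] Y)) : Prop :=
  ∀ X : M, IsIso (cotensorComparison V ε X)

/-- The pullback-hom `(B ⟶[V] X) ⟶ (A ⟶[V] X) ×_{A ⟶[V] Y} (B ⟶[V] Y)` of `j : A ⟶ B` and
`p : X ⟶ Y`. -/
noncomputable def pullbackHom {A B X Y : M} (j : A ⟶ B) (p : X ⟶ Y) :
    (B ⟶[V] X) ⟶ pullback (eHomWhiskerLeft V A p) (eHomWhiskerRight V j Y) :=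
  pullback.lift (eHomWhiskerRight V j X) (eHomWhiskerLeft V B p)
    (eHom_whisker_exchange V j p).symm

variable [HasLimits M] [HasColimits M]

/-- A left semimodel structure on (the underlying category of) the `V`-category `M` makes it a left
`V`-semimodel category: `M` is tensored and cotensored over `V`, and satisfies the pushout-product
axiom for cofibrations with cofibrant domain and the unit axiom.

The pushout-product axiom is stated in adjoint form: the lifting of `i` against the pullback-hom of
`j` and `p` is the lifting of the pushout-product `i □ j` against `p`, so that the axiom says that
`i □ j` is a cofibration, which is acyclic if `i` or `j` is. -/
structure IsEnrichedSemimodel (A : LeftSemimodelStructure M) : Prop where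
  tensored (K : V) (X : M) : ∃ (T : M) (η : K ⟶ (X ⟶[V] T)), IsTensor V η
  cotensored (K : V) (Y : M) : ∃ (C : M) (ε : K ⟶ (C ⟶[V] Y)), IsCotensor V ε
  pushoutProduct {K L : V} {B C X Y : M} (i : K ⟶ L) (j : B ⟶ C) (p : X ⟶ Y) :
    IsCofibrant K → cofibrations V i → A.IsCofibrant B → A.Cof j → A.Fib p →
    (weakEquivalences V i ∨ A.W j ∨ A.W p) → HasLiftingProperty i (pullbackHom V j p)
  /-- If `q : Q ⟶ 𝟙` is a cofibrant replacement of the unit and `X` is cofibrant, then the induced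
  map `t : Q ⊗ X ⟶ X` is a weak equivalence. -/
  unit {Q : V} {X T : M} (q : Q ⟶ 𝟙_ V) (η : Q ⟶ (X ⟶[V] T)) (t : T ⟶ X) :
    IsCofibrant Q → weakEquivalences V q → A.IsCofibrant X → IsTensor V η →
    η ≫ eHomWhiskerLeft V X t = q ≫ eId V X → A.W t

/-! ### Enriched left Bousfield localization -/

/-- `f` induces a weak equivalence `RHom(Y, Z) ⟶ RHom(X, Z)` on derived `V`-mapping objects into the
fibrant object `Z`. These are computed as `V`-mapping objects out of cofibrant replacements. -/
def IsDerivedHomEquiv (A : LeftSemimodelStructure M) {X Y : M} (f : X ⟶ Y) (Z : M) : Prop :=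
  ∀ ⦃X' Y' : M⦄ (f' : X' ⟶ Y') (a : X' ⟶ X) (b : Y' ⟶ Y),
    A.IsCofibrant X' → A.IsCofibrant Y' → A.W a → A.W b → f' ≫ b = a ≫ f →
    weakEquivalences V (eHomWhiskerRight V f' Z)

/-- Fibrant `S`-local objects (in the `V`-enriched sense). -/
def IsFibrantLocal (A : LeftSemimodelStructure M) (S : MorphismProperty M) (Z : M) : Prop :=
  A.IsFibrant Z ∧ ∀ ⦃X Y : M⦄ (f : X ⟶ Y), S f → IsDerivedHomEquiv V A f Z

/-- `S`-local equivalences (in the `V`-enriched sense). -/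
def localEquivalences (A : LeftSemimodelStructure M) (S : MorphismProperty M) :
    MorphismProperty M :=
  fun _ _ f ↦ ∀ Z : M, IsFibrantLocal V A S Z → IsDerivedHomEquiv V A f Z

/-- `L` is the `V`-enriched left Bousfield localization of `A` at `S`, existing as a left
semimodel structure on the same category: it has the same cofibrations, and its weak equivalences
are the `S`-local equivalences. -/
structure IsEnrichedLBL (A : LeftSemimodelStructure M) (S : MorphismProperty M)
    (L : LeftSemimodelStructure M) : Prop where
  cof_eq : L.Cof = A.Cof
  w_eq : L.W = localEquivalences V A S

end Enriched

/-! ### Enriched adjunctions and Quillen pairs -/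

section Adjunction

variable {V : Type u} [Category.{v} V] [MonoidalCategory V]
variable {M : Type u₁} [Category.{v} M] [EnrichedOrdinaryCategory V M]
variable {N : Type u₂} [Category.{v} N] [EnrichedOrdinaryCategory V N]

/-- The functor between underlying categories induced by a `V`-functor. -/
noncomputable def underlying (U : EnrichedFunctor V N M) : N ⥤ M :=
  ForgetEnrichment.equivInverse V N ⋙ U.forget ⋙ ForgetEnrichment.equivFunctor V M

lemma underlying_map (U : EnrichedFunctor V N M) {X Y : N} (f : X ⟶ Y) :
    (underlying U).map f = (eHomEquiv V).symm (eHomEquiv V f ≫ U.map X Y) := rfl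

/-- A `V`-adjunction `F ⊣ U`, given by isomorphisms `(F X ⟶[V] Z) ≅ (X ⟶[V] U Z)` in `V` which are
`V`-natural in both variables. -/
structure EnrichedAdjunction (F : EnrichedFunctor V M N) (U : EnrichedFunctor V N M) where
  /-- the isomorphism of `V`-mapping objects -/
  homIso (X : M) (Z : N) : (F.obj X ⟶[V] Z) ≅ (X ⟶[V] U.obj Z)
  naturality_right (X : M) (Z Z' : N) :
    eComp V (F.obj X) Z Z' ≫ (homIso X Z').hom =
      ((homIso X Z).hom ⊗ₘ U.map Z Z') ≫ eComp V X (U.obj Z) (U.obj Z')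
  naturality_left (X X' : M) (Z : N) :
    F.map X X' ▷ (F.obj X' ⟶[V] Z) ≫ eComp V (F.obj X) (F.obj X') Z ≫ (homIso X Z).hom =
      (X ⟶[V] X') ◁ (homIso X' Z).hom ≫ eComp V X X' (U.obj Z)

/-- `U` sends maps in `P` to maps in `Q`. -/
def Preserves (U : EnrichedFunctor V N M) (P : MorphismProperty N) (Q : MorphismProperty M) :
    Prop :=
  ∀ ⦃X Y : N⦄ (f : X ⟶ Y), P f → Q ((underlying U).map f)

variable [HasLimits M] [HasColimits M] [HasLimits N] [HasColimits N]

/-- A `V`-adjunction `F ⊣ U` is a Quillen pair between left semimodel structures if the right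
adjoint `U` preserves fibrations and acyclic fibrations. -/
def EnrichedAdjunction.IsQuillenPair {F : EnrichedFunctor V M N} {U : EnrichedFunctor V N M}
    (_ : EnrichedAdjunction F U) (A : LeftSemimodelStructure M) (B : LeftSemimodelStructure N) :
    Prop :=
  Preserves U B.Fib A.Fib ∧ Preserves U B.AFib A.AFib

end Adjunction

end EnrichedSemimodel

open EnrichedSemimodel

/-!
The statement is reduced to two facts: a `V`-adjunction between tractable left `V`-semimodel
categories is a Quillen pair as soon as the right adjoint preserves acyclic fibrations and fibrant
objects (`EnrichedAdjunction.isQuillenPair_iff`), and the fibrant objects of the localization are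
the fibrant `S`-local objects (`IsEnrichedLBL.isFibrant_iff`). The localization has the same
acyclic fibrations as the original structure, since these are determined by the cofibrations, so
both parts follow by applying the first fact to the localization as target or source.

Both facts rest on a lifting criterion (`IsEnrichedSemimodel.hasLiftingProperty`): a cofibration `j`
with cofibrant domain lifts against a fibration `p` if the pullback-hom of `j` and `p` is a weak
equivalence in `V`. Two points need care, as the unit of `V` is not assumed to be cofibrant and `V`
is not assumed to be tractable.
* Lifting problems are first solved after tensoring with a cofibrant replacement `Q` of the unit.
  The unit axiom makes `Q ⊗ X ⟶ X` a weak equivalence, and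
  `LeftSemimodelStructure.exists_lift_of_cofibrant_replacement` descends the solution.
* The pushout-product axiom only gives lifting properties of pullback-homs against (acyclic)
  cofibrations with cofibrant domain. The weak equivalences needed are still obtained from
  `weakEquivalence_of_rlp_cofibrantCofibrations`.

A local object `Z` is fibrant in the localization because an acyclic cofibration `j` of the
localization induces a weak equivalence on mapping objects into `Z`, so that the criterion applies
to `Z ⟶ *`; conversely, Ken Brown's lemma shows that fibrant objects of the localization are local.
For the recognition of Quillen pairs, let `j` be an acyclic cofibration with cofibrant domain. Then
`F j` induces weak equivalences on mapping objects into fibrant objects, by adjunction; so it lifts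
against fibrations between fibrant objects by the criterion, and is a weak equivalence by the
retract argument. By tractability this shows that the right adjoint preserves fibrations.
-/

namespace EnrichedSemimodel

/-! ### Lifting properties in left semimodel categories -/

namespace LeftSemimodelStructure

attribute [instance] twoOutOfThree retract_W retract_Cof retract_Fib baseChange_Fib

variable {M : Type u₁} [Category.{v} M] [HasColimits M]
  (A : LeftSemimodelStructure M)

/-- The acyclic cofibrations with cofibrant domain: these are the acyclic cofibrations against which
fibrations are required to lift. -/
def ACof : MorphismProperty M := fun X _ i ↦ A.IsCofibrant X ∧ A.Cof i ∧ A.W i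

lemma aFib_eq_rlp_cof : A.AFib = A.Cof.rlp := by
  refine le_antisymm (fun _ _ p hp _ _ i hi ↦ A.lift_cof_acyclicFib i p hi hp.1 hp.2)
    (fun _ _ p hp ↦ ?_)
  obtain ⟨Z, i, q, hi, hq, hq', fac⟩ := A.factor_cof_acyclicFib p
  have := hp _ hi
  have h := RetractArrow.ofRightLiftingProperty fac
  exact ⟨MorphismProperty.of_retract h hq, MorphismProperty.of_retract h hq'⟩

lemma cof_eq_llp_aFib : A.Cof = A.AFib.llp := by
  refine le_antisymm (fun _ _ i hi _ _ p hp ↦ A.lift_cof_acyclicFib i p hi hp.1 hp.2)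
    (fun _ _ i hi ↦ ?_)
  obtain ⟨Z, j, q, hj, hq, hq', fac⟩ := A.factor_cof_acyclicFib i
  have := hi _ ⟨hq, hq'⟩
  exact MorphismProperty.of_retract (RetractArrow.ofLeftLiftingProperty fac) hj

instance : A.Cof.IsMultiplicative := by rw [cof_eq_llp_aFib]; infer_instance

instance : A.Cof.IsStableUnderCobaseChange := by rw [cof_eq_llp_aFib]; infer_instance

lemma w_id (X : M) : A.W (𝟙 X) := by
  have : A.AFib (𝟙 X) := by rw [aFib_eq_rlp_cof]; exact MorphismProperty.id_mem _ _
  exact this.2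

variable {A}

lemma IsCofibrant.of_cof {X Y : M} {i : X ⟶ Y} (hX : A.IsCofibrant X) (hi : A.Cof i) :
    A.IsCofibrant Y := by
  have := A.Cof.comp_mem _ _ hX hi
  rwa [Subsingleton.elim (initial.to X ≫ i) (initial.to Y)] at this

lemma isCofibrant_of_isInitial {X : M} (hX : IsInitial X) : A.IsCofibrant X := by
  have : IsIso (initial.to X) :=
    (initialIsInitial.uniqueUpToIso hX).isIso_hom
  rw [IsCofibrant, cof_eq_llp_aFib]
  exact MorphismProperty.llp_of_isIso _ _

lemma IsCofibrant.of_initial_cof {I X : M} (hI : IsInitial I) {i : I ⟶ X} (hi : A.Cof i) :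
    A.IsCofibrant X :=
  (isCofibrant_of_isInitial hI).of_cof hi

/-- Acyclic cofibrations with cofibrant domain are the maps with cofibrant domain which lift against
fibrations. -/
lemma ACof.iff_llp_fib {X Y : M} (i : X ⟶ Y) (hX : A.IsCofibrant X) :
    A.ACof i ↔ A.Fib.llp i := by
  refine ⟨fun hi _ _ p hp ↦ A.lift_acyclicCof_fib i p hX hi.2.1 hi.2.2 hp, fun hi ↦ ?_⟩
  obtain ⟨Z, j, q, hj, hj', hq, fac⟩ := A.factor_acyclicCof_fib i hX
  have := hi _ hq
  have h := RetractArrow.ofLeftLiftingProperty fac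
  exact ⟨hX, MorphismProperty.of_retract h hj, MorphismProperty.of_retract h hj'⟩

/-- Acyclic cofibrations with cofibrant domain are stable under pushout along maps with
cofibrant codomain. -/
lemma ACof.of_isPushout {X X' Y Y' : M} {i : X ⟶ X'} {f : X ⟶ Y} {f' : X' ⟶ Y'} {i' : Y ⟶ Y'}
    (h : IsPushout f i i' f') (hi : A.ACof i) (hY : A.IsCofibrant Y) : A.ACof i' := by
  rw [ACof.iff_llp_fib _ hi.1] at hi
  rw [ACof.iff_llp_fib _ hY]
  exact MorphismProperty.of_isPushout h hi

/-- In a tractable semimodel category, acyclic cofibrations with cofibrant domain detect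
fibrations. -/
lemma IsTractable.fib_eq (hA : A.IsTractable) : A.Fib = A.ACof.rlp := by
  obtain ⟨I, J, -, -, -, hJ, -, hJ'⟩ := hA
  refine le_antisymm
    (fun _ _ p hp _ _ i hi ↦ A.lift_acyclicCof_fib i p hi.1 hi.2.1 hi.2.2 hp) ?_
  rw [hJ]
  refine MorphismProperty.antitone_rlp (fun X Y j hj ↦ ?_)
  rw [ACof.iff_llp_fib _ (hJ' j hj).1, hJ]
  exact J.le_llp_rlp _ hj

/-- Brown's factorization: a weak equivalence between cofibrant objects is an acyclic cofibration
followed by a retraction of an acyclic cofibration. -/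
lemma exists_brown_factorization {X Y : M} (f : X ⟶ Y) (hX : A.IsCofibrant X)
    (hY : A.IsCofibrant Y) (hf : A.W f) :
    ∃ (C : M) (i : X ⟶ C) (s : Y ⟶ C) (r : C ⟶ Y), A.ACof i ∧ A.ACof s ∧ i ≫ r = f ∧
      s ≫ r = 𝟙 Y := by
  obtain ⟨C, k, r, hk, -, hr, fac⟩ := A.factor_cof_acyclicFib (coprod.desc f (𝟙 Y))
  have sq : IsPushout (initial.to X) (initial.to Y) (coprod.inl : X ⟶ X ⨿ Y) coprod.inr :=
    (IsPushout.of_isColimit_binaryCofan_of_isInitial (colimit.isColimit (pair X Y))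
      initialIsInitial).flip
  have hi : (coprod.inl ≫ k) ≫ r = f := by rw [assoc, fac, coprod.inl_desc]
  have hs : (coprod.inr ≫ k) ≫ r = 𝟙 Y := by rw [assoc, fac, coprod.inr_desc]
  refine ⟨C, coprod.inl ≫ k, coprod.inr ≫ k, r,
    ⟨hX, A.Cof.comp_mem _ _ (MorphismProperty.of_isPushout sq hY) hk, ?_⟩,
    ⟨hY, A.Cof.comp_mem _ _ (MorphismProperty.of_isPushout sq.flip hX) hk, ?_⟩, hi, hs⟩
  · exact A.W.of_postcomp _ r hr (by rwa [hi])
  · exact A.W.of_postcomp _ r hr (by rw [hs]; exact A.w_id Y)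

/-- A lifting problem for a cofibration `j` against a fibration `p` can be solved if the problem
obtained by precomposition with a weakly equivalent cofibration `j₀` can be solved. -/
lemma exists_lift_of_cofibrant_replacement {X₀ X Y₀ Y E B : M} {j₀ : X₀ ⟶ Y₀} {j : X ⟶ Y}
    {a : X₀ ⟶ X} {b : Y₀ ⟶ Y} {p : E ⟶ B} (w : j₀ ≫ b = a ≫ j)
    (hX₀ : A.IsCofibrant X₀) (hX : A.IsCofibrant X) (hj₀ : A.Cof j₀) (hj : A.Cof j)
    (ha : A.W a) (hb : A.W b) (hp : A.Fib p)
    (φ : X ⟶ E) (χ : Y ⟶ B) (ψ : Y₀ ⟶ E)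
    (hφχ : φ ≫ p = j ≫ χ) (hψ : j₀ ≫ ψ = a ≫ φ) (hψ' : ψ ≫ p = b ≫ χ) :
    ∃ l : Y ⟶ E, j ≫ l = φ ∧ l ≫ p = χ := by
  have hY₀ : A.IsCofibrant Y₀ := hX₀.of_cof hj₀
  obtain ⟨C, i, s, r, hi, hs, hir, hsr⟩ := exists_brown_factorization a hX₀ hX ha
  have sq := IsPushout.of_hasPushout j₀ i
  have hi' : A.ACof (pushout.inl j₀ i) := ACof.of_isPushout sq hi hY₀
  -- The pushout `Y₁` of `Y₀` along `i` replaces `a` by its retraction part `r`; the section `s`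
  -- then exhibits `Y₁ ⟶ Y` as a weak equivalence under `X`.
  let b₁ : pushout j₀ i ⟶ Y := pushout.desc b (r ≫ j) (by rw [reassoc_of% hir, w])
  let ψ₁ : pushout j₀ i ⟶ E := pushout.desc ψ (r ≫ φ) (by rw [reassoc_of% hir, hψ])
  have hb₁ : A.W b₁ := A.W.of_precomp (pushout.inl j₀ i) b₁ hi'.2.2
    (by rw [pushout.inl_desc]; exact hb)
  have hψ₁ : ψ₁ ≫ p = b₁ ≫ χ := by
    apply pushout.hom_ext
    · rw [pushout.inl_desc_assoc, pushout.inl_desc_assoc, hψ']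
    · rw [pushout.inr_desc_assoc, pushout.inr_desc_assoc, assoc, assoc, hφχ]
  have hY₁ : A.IsCofibrant (pushout j₀ i) := hY₀.of_cof hi'.2.1
  obtain ⟨R, k, q, hk, hk', hq, fac⟩ := A.factor_acyclicCof_fib b₁ hY₁
  have hq' : A.W q := A.W.of_precomp k q hk' (by rwa [fac])
  have := A.lift_acyclicCof_fib k p hY₁ hk hk' hp
  have := A.lift_cof_acyclicFib j q hj hq hq'
  have sq₁ : CommSq ψ₁ k p (q ≫ χ) := ⟨by rw [hψ₁, reassoc_of% fac]⟩
  have sq₂ : CommSq (s ≫ pushout.inr j₀ i ≫ k) j q (𝟙 Y) :=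
    ⟨by rw [assoc, assoc, fac, pushout.inr_desc, reassoc_of% hsr, comp_id]⟩
  refine ⟨sq₂.lift ≫ sq₁.lift, ?_, ?_⟩
  · rw [sq₂.fac_left_assoc, assoc, assoc, sq₁.fac_left, pushout.inr_desc, reassoc_of% hsr]
  · rw [assoc, sq₁.fac_right, sq₂.fac_right_assoc, id_comp]

end LeftSemimodelStructure

/-! ### Maps lifting against cofibrations with cofibrant domain -/

section Base

variable (V : Type u) [Category.{v} V] [ModelCategory V]

/-- The cofibrations with cofibrant domain. -/
def cofibrantCofibrations : MorphismProperty V := fun K _ i ↦ IsCofibrant K ∧ cofibrations V i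

/-- The acyclic cofibrations with cofibrant domain. -/
def cofibrantTrivialCofibrations : MorphismProperty V :=
  fun K _ i ↦ IsCofibrant K ∧ trivialCofibrations V i

variable {V}

lemma exists_cofibrant_replacement (X : V) :
    ∃ (Q : V) (q : Q ⟶ X), IsCofibrant Q ∧ Fibration q ∧ WeakEquivalence q := by
  let d := MorphismProperty.factorizationData (cofibrations V) (trivialFibrations V) (initial.to X)
  refine ⟨d.Z, d.p, ?_, ⟨d.hp.1⟩, ⟨d.hp.2⟩⟩
  rw [isCofibrant_iff, Subsingleton.elim (initial.to d.Z) d.i]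
  exact ⟨d.hi⟩

/-- In a model category which is not assumed to be tractable, a map lifting against cofibrations
with cofibrant domain need not be an acyclic fibration, but it is still a weak equivalence. -/
lemma weakEquivalence_of_rlp_cofibrantCofibrations {P R : V} (f : P ⟶ R)
    (hf : (cofibrantCofibrations V).rlp f) : weakEquivalences V f := by
  obtain ⟨Q, q, hQ, hq', hq⟩ := exists_cofibrant_replacement P
  let d := MorphismProperty.factorizationData (cofibrations V) (trivialFibrations V) (q ≫ f)
  have hd : WeakEquivalence d.p := ⟨d.hp.2⟩
  have hd' : Fibration d.p := ⟨d.hp.1⟩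
  have hdi : Cofibration d.i := ⟨d.hi⟩
  have := hf d.i ⟨hQ, d.hi⟩
  have : HasLiftingProperty d.i (q ≫ f) := inferInstance
  have sq : CommSq (𝟙 Q) d.i (q ≫ f) d.p := ⟨by rw [d.fac, id_comp]⟩
  -- The lift `h` is a retraction of `d.i`, and `h ≫ d.i` is homotopic to the identity since both
  -- maps agree after composition with the acyclic fibration `d.p`.
  obtain ⟨c, hc⟩ := Cylinder.exists_very_good d.Z
  have sq' : CommSq (coprod.desc (𝟙 d.Z) (sq.lift ≫ d.i)) c.i d.p (c.π ≫ d.p) := ⟨by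
    ext
    · simp [Precylinder.i]
    · simp [Precylinder.i]⟩
  have h₀ : c.i₀ ≫ sq'.lift = 𝟙 _ := by
    rw [← c.inl_i, assoc, sq'.fac_left, coprod.inl_desc]
  have h₁ : c.i₁ ≫ sq'.lift = sq.lift ≫ d.i := by
    rw [← c.inr_i, assoc, sq'.fac_left, coprod.inr_desc]
  have : WeakEquivalence sq'.lift := weakEquivalence_of_precomp_of_fac h₀
  have hr : WeakEquivalence (sq.lift ≫ d.i) := by rw [← h₁]; infer_instance
  have r : RetractArrow d.i (sq.lift ≫ d.i) :=
    { i := Arrow.homMk d.i (𝟙 _) (by simp [sq.fac_left_assoc])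
      r := Arrow.homMk sq.lift (𝟙 _) (by simp)
      retract := by ext <;> simp [sq.fac_left] }
  have : WeakEquivalence d.i := ⟨MorphismProperty.of_retract r hr.mem⟩
  have : WeakEquivalence (q ≫ f) := by rw [← d.fac]; infer_instance
  exact (weakEquivalence_of_precomp q f).mem

/-- Weak equivalences lifting against acyclic cofibrations with cofibrant domain are surjective
on maps out of cofibrant objects. -/
lemma exists_lift_of_isCofibrant {E B Q : V} [IsCofibrant Q] (g : E ⟶ B)
    (hg : (cofibrantTrivialCofibrations V).rlp g) (hg' : weakEquivalences V g) (x : Q ⟶ B) :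
    ∃ y : Q ⟶ E, y ≫ g = x := by
  have : WeakEquivalence g := ⟨hg'⟩
  obtain ⟨E', e, hE, -, he⟩ := exists_cofibrant_replacement E
  let k := MorphismProperty.factorizationData (trivialCofibrations V) (fibrations V) (e ≫ g)
  have := hg k.i ⟨hE, k.hi⟩
  have hk : WeakEquivalence k.i := ⟨k.hi.2⟩
  have hk' : Fibration k.p := ⟨k.hp⟩
  have : WeakEquivalence k.p := weakEquivalence_of_precomp_of_fac k.fac
  have sq : CommSq e k.i g k.p := ⟨k.fac.symm⟩
  have sq' : CommSq (initial.to k.Z) (initial.to Q) k.p x := ⟨Subsingleton.elim _ _⟩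
  exact ⟨sq'.lift ≫ sq.lift, by rw [assoc, sq.fac_right, sq'.fac_right]⟩

end Base

/-! ### Maps out of tensors and into cotensors -/

section Tensors

variable (V : Type u) [Category.{v} V] [MonoidalCategory V]
  {M : Type u₁} [Category.{v} M] [EnrichedOrdinaryCategory V M]

lemma eHomEquiv_whiskerLeft {X Y Z : M} (f : X ⟶ Y) (g : Y ⟶ Z) :
    eHomEquiv V f ≫ eHomWhiskerLeft V X g = eHomEquiv V (f ≫ g) := by
  rw [eHomWhiskerLeft, eHomEquiv_comp, rightUnitor_inv_naturality_assoc, ← unitors_inv_equal,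
    MonoidalCategory.tensorHom_def, assoc]

lemma eHomEquiv_whiskerRight {X Y Z : M} (f : X ⟶ Y) (g : Y ⟶ Z) :
    eHomEquiv V g ≫ eHomWhiskerRight V f Z = eHomEquiv V (f ≫ g) := by
  rw [eHomWhiskerRight, eHomEquiv_comp, leftUnitor_inv_naturality_assoc,
    MonoidalCategory.tensorHom_def', assoc]

lemma eId_whiskerLeft {X Y : M} (f : X ⟶ Y) :
    eId V X ≫ eHomWhiskerLeft V X f = eHomEquiv V f := by
  rw [← eHomEquiv_id, eHomEquiv_whiskerLeft, id_comp]

lemma eId_whiskerRight {X Y : M} (f : X ⟶ Y) :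
    eId V Y ≫ eHomWhiskerRight V f Y = eHomEquiv V f := by
  rw [← eHomEquiv_id, eHomEquiv_whiskerRight, comp_id]

variable {V} [MonoidalClosed V]

/-- The universal property of a tensor `T = K ⊗ X` on underlying categories. -/
lemma IsTensor.bijective {K : V} {X T : M} {η : K ⟶ (X ⟶[V] T)} (hη : IsTensor V η) (Y : M) :
    Function.Bijective (fun t : T ⟶ Y ↦ η ≫ eHomWhiskerLeft V X t) := by
  have := hη Y
  let e : (T ⟶ Y) ≃ (K ⟶ (X ⟶[V] Y)) :=
    (eHomEquiv V).trans ((Iso.homToEquiv (asIso (tensorComparison V η Y))).trans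
      (((ihom.adjunction K).homEquiv _ _).symm.trans (Iso.homFromEquiv (ρ_ K))))
  convert e.bijective using 2 with t
  change _ = (ρ_ K).inv ≫ MonoidalClosed.uncurry (eHomEquiv V t ≫ tensorComparison V η Y)
  rw [MonoidalClosed.uncurry_natural_left, tensorComparison, MonoidalClosed.uncurry_curry,
    whisker_exchange_assoc, ← rightUnitor_inv_naturality_assoc, eHomWhiskerLeft]

variable [SymmetricCategory V]

/-- The universal property of a cotensor `C = Y ^ K` on underlying categories. -/
lemma IsCotensor.bijective {K : V} {C Y : M} {ε : K ⟶ (C ⟶[V] Y)} (hε : IsCotensor V ε) (X : M) :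
    Function.Bijective (fun c : X ⟶ C ↦ ε ≫ eHomWhiskerRight V c Y) := by
  have := hε X
  let e : (X ⟶ C) ≃ (K ⟶ (X ⟶[V] Y)) :=
    (eHomEquiv V).trans ((Iso.homToEquiv (asIso (cotensorComparison V ε X))).trans
      (((ihom.adjunction K).homEquiv _ _).symm.trans (Iso.homFromEquiv (ρ_ K))))
  convert e.bijective using 2 with t
  change _ = (ρ_ K).inv ≫ MonoidalClosed.uncurry (eHomEquiv V t ≫ cotensorComparison V ε X)
  rw [MonoidalClosed.uncurry_natural_left, cotensorComparison, MonoidalClosed.uncurry_curry,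
    BraidedCategory.braiding_naturality_right_assoc, braiding_tensorUnit_right]
  simp only [assoc, Iso.inv_hom_id_assoc]
  rw [← whisker_exchange_assoc, ← leftUnitor_inv_naturality_assoc, eHomWhiskerRight]

variable [ModelCategory V] [HasColimits M] {A : LeftSemimodelStructure M}

lemma IsEnrichedSemimodel.subsingleton_hom_of_isInitial (hA : IsEnrichedSemimodel V A) {X : M}
    (hX : IsInitial X) (K : V) (Y : M) : Subsingleton (K ⟶ (X ⟶[V] Y)) := by
  obtain ⟨C, ε, hε⟩ := hA.cotensored K Y
  refine ⟨fun f g ↦ ?_⟩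
  obtain ⟨f, rfl⟩ := (hε.bijective X).2 f
  obtain ⟨g, rfl⟩ := (hε.bijective X).2 g
  rw [hX.hom_ext f g]

/-- `V`-mapping objects into a terminal object are terminal. -/
noncomputable def IsEnrichedSemimodel.isTerminalHom (hA : IsEnrichedSemimodel V A) (X : M)
    {Y : M} (hY : IsTerminal Y) : IsTerminal (X ⟶[V] Y) :=
  IsTerminal.ofUniqueHom
    (fun K ↦ (hA.tensored K X).choose_spec.choose ≫ eHomWhiskerLeft V X (hY.from _))
    (fun K f ↦ by
      obtain ⟨t, rfl⟩ := ((hA.tensored K X).choose_spec.choose_spec.bijective Y).2 f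
      rw [hY.hom_ext t (hY.from _)])

end Tensors

/-! ### Pullback-homs -/

section PullbackHom

variable {V : Type u} [Category.{v} V] [MonoidalCategory V] [ModelCategory V]
  {M : Type u₁} [Category.{v} M] [EnrichedOrdinaryCategory V M]

@[simp]
lemma pullbackHom_fst {X Y E B : M} (j : X ⟶ Y) (p : E ⟶ B) :
    pullbackHom V j p ≫ pullback.fst _ _ = eHomWhiskerRight V j E :=
  pullback.lift_fst _ _ _

@[simp]
lemma pullbackHom_snd {X Y E B : M} (j : X ⟶ Y) (p : E ⟶ B) :
    pullbackHom V j p ≫ pullback.snd _ _ = eHomWhiskerLeft V Y p :=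
  pullback.lift_snd _ _ _

variable [SymmetricCategory V] [MonoidalClosed V] [HasColimits M] {A : LeftSemimodelStructure M}

/-- The pullback-hom of `j : X ⟶ Y` and a map from `Z` to a terminal object is the restriction
`(Y ⟶[V] Z) ⟶ (X ⟶[V] Z)` up to isomorphism. -/
lemma IsEnrichedSemimodel.isIso_pullback_fst (hA : IsEnrichedSemimodel V A) {X Y Z T : M}
    (hT : IsTerminal T) (j : X ⟶ Y) (p : Z ⟶ T) :
    IsIso (pullback.fst (eHomWhiskerLeft V X p) (eHomWhiskerRight V j T)) := by
  have : IsIso (eHomWhiskerRight V j T) :=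
    isIso_of_isTerminal (hA.isTerminalHom Y hT) (hA.isTerminalHom X hT) _
  infer_instance

/-- The pullback-hom of a cofibration with cofibrant domain and a fibration lifts against acyclic
cofibrations with cofibrant domain. -/
lemma IsEnrichedSemimodel.rlp_pullbackHom (hA : IsEnrichedSemimodel V A) {X Y E B : M}
    {j : X ⟶ Y} {p : E ⟶ B} (hX : A.IsCofibrant X) (hj : A.Cof j) (hp : A.Fib p) :
    (cofibrantTrivialCofibrations V).rlp (pullbackHom V j p) :=
  fun _ _ i hi ↦ hA.pushoutProduct i j p hi.1 hi.2.1 hX hj hp (.inl hi.2.2)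

/-- If `Q` and `X` are cofibrant, tensoring a cofibration `j : X ⟶ Y` with `Q` gives a
cofibration. -/
lemma IsEnrichedSemimodel.cof_tensor (hA : IsEnrichedSemimodel V A) {Q : V} [IsCofibrant Q]
    {X Y TX TY : M} {ηX : Q ⟶ (X ⟶[V] TX)} {ηY : Q ⟶ (Y ⟶[V] TY)}
    (hηX : IsTensor V ηX) (hηY : IsTensor V ηY) {j : X ⟶ Y} {j₀ : TX ⟶ TY}
    (w : ηX ≫ eHomWhiskerLeft V X j₀ = ηY ≫ eHomWhiskerRight V j TY)
    (hX : A.IsCofibrant X) (hj : A.Cof j) : A.Cof j₀ := by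
  rw [A.cof_eq_llp_aFib]
  intro E B p hp
  have hI : IsCofibrant (⊥_ V) := by
    rw [isCofibrant_iff, Subsingleton.elim (initial.to (⊥_ V)) (𝟙 _)]
    infer_instance
  have := hA.pushoutProduct (initial.to Q) j p hI (mem_cofibrations _) hX hj hp.1
    (.inr (.inr hp.2))
  refine ⟨fun {f g} sq ↦ ?_⟩
  have sq' : CommSq (initial.to _) (initial.to Q) (pullbackHom V j p)
      (pullback.lift (ηX ≫ eHomWhiskerLeft V X f) (ηY ≫ eHomWhiskerLeft V Y g) (by
        rw [assoc, assoc, ← eHomWhiskerLeft_comp, sq.w, eHom_whisker_exchange,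
          eHomWhiskerLeft_comp, reassoc_of% w])) := ⟨Subsingleton.elim _ _⟩
  have h₁ : sq'.lift ≫ eHomWhiskerRight V j E = ηX ≫ eHomWhiskerLeft V X f := by
    rw [← pullbackHom_fst j p, reassoc_of% sq'.fac_right, pullback.lift_fst]
  have h₂ : sq'.lift ≫ eHomWhiskerLeft V Y p = ηY ≫ eHomWhiskerLeft V Y g := by
    rw [← pullbackHom_snd j p, reassoc_of% sq'.fac_right, pullback.lift_snd]
  obtain ⟨l, hl⟩ := (hηY.bijective E).2 sq'.lift
  dsimp only at hl
  refine ⟨⟨⟨l, (hηX.bijective E).1 ?_, (hηY.bijective B).1 ?_⟩⟩⟩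
  · dsimp only
    rw [eHomWhiskerLeft_comp, reassoc_of% w, ← eHom_whisker_exchange, reassoc_of% hl, h₁]
  · dsimp only
    rw [eHomWhiskerLeft_comp, reassoc_of% hl, h₂]

lemma IsEnrichedSemimodel.isCofibrant_tensor (hA : IsEnrichedSemimodel V A) {Q : V}
    [IsCofibrant Q] {X T : M} {η : Q ⟶ (X ⟶[V] T)} (hη : IsTensor V η) (hX : A.IsCofibrant X) :
    A.IsCofibrant T := by
  -- `T` is the target of `Q ⊗ (⊥_ M ⟶ X)`, whose source is initial by the universal property of
  -- cotensors
  obtain ⟨T₀, η₀, hη₀⟩ := hA.tensored Q (⊥_ M)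
  have hT₀ : IsInitial T₀ := IsInitial.ofUniqueHom
    (fun Y ↦ ((hη₀.bijective Y).2
      ((hA.cotensored Q Y).choose_spec.choose ≫ eHomWhiskerRight V (initial.to _) Y)).choose)
    (fun Y f ↦ (hη₀.bijective Y).1
      ((hA.subsingleton_hom_of_isInitial initialIsInitial Q Y).elim _ _))
  obtain ⟨j₀, hj₀⟩ := (hη₀.bijective T).2 (η ≫ eHomWhiskerRight V (initial.to X) T)
  exact .of_initial_cof hT₀
    (hA.cof_tensor hη₀ hη hj₀
      (LeftSemimodelStructure.isCofibrant_of_isInitial initialIsInitial) hX)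

/-- If the pullback-hom of a cofibration `j` with cofibrant domain and a fibration `p` is a weak
equivalence, then `j` lifts against `p`. As the unit of `V` need not be cofibrant, this uses
a cofibrant replacement `Q` of the unit: the pullback-hom is surjective on maps out of `Q`, which
solves the lifting problem for `Q ⊗ j`, and the unit axiom allows to descend to `j`. -/
lemma IsEnrichedSemimodel.hasLiftingProperty (hA : IsEnrichedSemimodel V A) {X Y E B : M}
    {j : X ⟶ Y} {p : E ⟶ B} (hX : A.IsCofibrant X) (hj : A.Cof j) (hp : A.Fib p)
    (h : weakEquivalences V (pullbackHom V j p)) : HasLiftingProperty j p := by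
  refine ⟨fun {φ χ} sq ↦ ?_⟩
  obtain ⟨Q, q, hQ, -, hq⟩ := exists_cofibrant_replacement (𝟙_ V)
  obtain ⟨y, hy⟩ := exists_lift_of_isCofibrant _ (hA.rlp_pullbackHom hX hj hp) h
    (pullback.lift (q ≫ eHomEquiv V φ) (q ≫ eHomEquiv V χ) (by
      rw [assoc, assoc, eHomEquiv_whiskerLeft, eHomEquiv_whiskerRight, sq.w]))
  have hy₁ : y ≫ eHomWhiskerRight V j E = q ≫ eHomEquiv V φ := by
    rw [← pullbackHom_fst j p, reassoc_of% hy, pullback.lift_fst]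
  have hy₂ : y ≫ eHomWhiskerLeft V Y p = q ≫ eHomEquiv V χ := by
    rw [← pullbackHom_snd j p, reassoc_of% hy, pullback.lift_snd]
  obtain ⟨TX, ηX, hηX⟩ := hA.tensored Q X
  obtain ⟨TY, ηY, hηY⟩ := hA.tensored Q Y
  obtain ⟨tX, htX⟩ := (hηX.bijective X).2 (q ≫ eId V X)
  obtain ⟨tY, htY⟩ := (hηY.bijective Y).2 (q ≫ eId V Y)
  obtain ⟨j₀, hj₀⟩ := (hηX.bijective TY).2 (ηY ≫ eHomWhiskerRight V j TY)
  obtain ⟨ψ, hψ⟩ := (hηY.bijective E).2 y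
  dsimp only at htX htY hj₀ hψ
  obtain ⟨l, hl, hl'⟩ := LeftSemimodelStructure.exists_lift_of_cofibrant_replacement
    (j₀ := j₀) (j := j) (a := tX) (b := tY) (p := p)
    ((hηX.bijective Y).1 (by
      dsimp only
      rw [eHomWhiskerLeft_comp, eHomWhiskerLeft_comp, reassoc_of% hj₀, reassoc_of% htX,
        ← eHom_whisker_exchange, reassoc_of% htY, eId_whiskerLeft, eId_whiskerRight]))
    (hA.isCofibrant_tensor hηX hX) hX (hA.cof_tensor hηX hηY hj₀ hX hj) hj
    (hA.unit q ηX tX hQ hq.mem hX hηX htX) (hA.unit q ηY tY hQ hq.mem (hX.of_cof hj) hηY htY) hp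
    φ χ ψ sq.w
    ((hηX.bijective E).1 (by
      dsimp only
      rw [eHomWhiskerLeft_comp, eHomWhiskerLeft_comp, reassoc_of% hj₀, reassoc_of% htX,
        ← eHom_whisker_exchange, reassoc_of% hψ, eId_whiskerLeft, hy₁]))
    ((hηY.bijective B).1 (by
      dsimp only
      rw [eHomWhiskerLeft_comp, eHomWhiskerLeft_comp, reassoc_of% hψ, reassoc_of% htY,
        eId_whiskerLeft, hy₂]))
  exact ⟨⟨⟨l, hl, hl'⟩⟩⟩

end PullbackHom

/-! ### Derived mapping objects and the local objects of a localization -/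

section Localization

variable {V : Type u} [Category.{v} V] [MonoidalCategory V] [ModelCategory V]
  {M : Type u₁} [Category.{v} M] [EnrichedOrdinaryCategory V M] [HasColimits M]
  {A : LeftSemimodelStructure M}

lemma IsDerivedHomEquiv.weakEquivalence {X Y Z : M} {f : X ⟶ Y} (h : IsDerivedHomEquiv V A f Z)
    (hX : A.IsCofibrant X) (hY : A.IsCofibrant Y) :
    weakEquivalences V (eHomWhiskerRight V f Z) :=
  h f (𝟙 X) (𝟙 Y) hX hY (A.w_id X) (A.w_id Y) (by rw [id_comp, comp_id])

variable [HasLimits M] {L : LeftSemimodelStructure M} {S : MorphismProperty M}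

namespace IsEnrichedLBL

lemma isCofibrant_iff (hL : IsEnrichedLBL V A S L) (X : M) :
    L.IsCofibrant X ↔ A.IsCofibrant X := by
  rw [LeftSemimodelStructure.IsCofibrant, hL.cof_eq, LeftSemimodelStructure.IsCofibrant]

lemma aFib_eq (hL : IsEnrichedLBL V A S L) : L.AFib = A.AFib := by
  rw [L.aFib_eq_rlp_cof, hL.cof_eq, A.aFib_eq_rlp_cof]

lemma le_w (hL : IsEnrichedLBL V A S L) : S ≤ L.W := by
  rw [hL.w_eq]
  exact fun _ _ f hf Z hZ ↦ hZ.2 f hf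

end IsEnrichedLBL

variable [SymmetricCategory V] [MonoidalClosed V]

lemma IsEnrichedSemimodel.rlp_eHomWhiskerRight (hA : IsEnrichedSemimodel V A) {X Y Z : M}
    {j : X ⟶ Y} (hj : A.ACof j) (hZ : A.IsFibrant Z) :
    (cofibrantCofibrations V).rlp (eHomWhiskerRight V j Z) := by
  have := hA.isIso_pullback_fst terminalIsTerminal j (terminal.from Z)
  rw [← pullbackHom_fst j (terminal.from Z)]
  exact MorphismProperty.comp_mem _ _ _
    (fun _ _ i hi ↦ hA.pushoutProduct i j _ hi.1 hi.2 hj.1 hj.2.1 hZ (.inr (.inl hj.2.2)))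
    (MorphismProperty.rlp_of_isIso _ _)

/-- Ken Brown's lemma for mapping objects into a fibrant object. -/
lemma IsEnrichedSemimodel.weakEquivalence_eHomWhiskerRight (hA : IsEnrichedSemimodel V A)
    {X Y Z : M} {f : X ⟶ Y} (hX : A.IsCofibrant X) (hY : A.IsCofibrant Y) (hf : A.W f)
    (hZ : A.IsFibrant Z) : weakEquivalences V (eHomWhiskerRight V f Z) := by
  obtain ⟨C, i, s, r, hi, hs, hir, hsr⟩ :=
    LeftSemimodelStructure.exists_brown_factorization f hX hY hf
  have hs' : eHomWhiskerRight V r Z ≫ eHomWhiskerRight V s Z = 𝟙 _ := by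
    rw [← eHomWhiskerRight_comp, hsr, eHomWhiskerRight_id]
  have : WeakEquivalence (eHomWhiskerRight V i Z) :=
    ⟨weakEquivalence_of_rlp_cofibrantCofibrations _ (hA.rlp_eHomWhiskerRight hi hZ)⟩
  have : WeakEquivalence (eHomWhiskerRight V s Z) :=
    ⟨weakEquivalence_of_rlp_cofibrantCofibrations _ (hA.rlp_eHomWhiskerRight hs hZ)⟩
  have : WeakEquivalence (eHomWhiskerRight V r Z) := weakEquivalence_of_postcomp_of_fac hs'
  rw [← hir, eHomWhiskerRight_comp]
  exact mem_weakEquivalences _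

lemma IsEnrichedSemimodel.isDerivedHomEquiv (hA : IsEnrichedSemimodel V A) {X Y Z : M}
    {f : X ⟶ Y} (hf : A.W f) (hZ : A.IsFibrant Z) : IsDerivedHomEquiv V A f Z := by
  intro X' Y' f' a b hX' hY' ha hb fac
  refine hA.weakEquivalence_eHomWhiskerRight hX' hY' (A.W.of_postcomp f' b hb ?_) hZ
  rw [fac]
  exact A.W.comp_mem _ _ ha hf

namespace IsEnrichedLBL

lemma w_le (hL : IsEnrichedLBL V A S L) (hA : IsEnrichedSemimodel V A) : A.W ≤ L.W := by
  rw [hL.w_eq]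
  exact fun _ _ f hf Z hZ ↦ hA.isDerivedHomEquiv hf hZ.1

lemma fib_le (hL : IsEnrichedLBL V A S L) (hA : IsEnrichedSemimodel V A) (hA' : A.IsTractable) :
    L.Fib ≤ A.Fib := by
  rw [hA'.fib_eq]
  exact fun _ _ p hp _ _ j hj ↦ L.lift_acyclicCof_fib j p ((hL.isCofibrant_iff _).2 hj.1)
    (by rw [hL.cof_eq]; exact hj.2.1) (hL.w_le hA _ hj.2.2) hp

/-- The fibrant objects of the enriched localization are the fibrant `S`-local objects. -/
lemma isFibrant_iff (hL : IsEnrichedLBL V A S L) (hA : IsEnrichedSemimodel V A)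
    (hA' : A.IsTractable) (hL₁ : IsEnrichedSemimodel V L) (hL₂ : L.IsTractable) (Z : M) :
    L.IsFibrant Z ↔ IsFibrantLocal V A S Z := by
  constructor
  · intro hZ
    refine ⟨hL.fib_le hA hA' _ hZ, fun X Y f hf X' Y' f' a b hX' hY' ha hb fac ↦ ?_⟩
    exact hL₁.isDerivedHomEquiv (hL.le_w _ hf) hZ f' a b ((hL.isCofibrant_iff _).2 hX')
      ((hL.isCofibrant_iff _).2 hY') (hL.w_le hA _ ha) (hL.w_le hA _ hb) fac
  · intro hZ
    rw [LeftSemimodelStructure.IsFibrant, hL₂.fib_eq]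
    intro X Y j hj
    have hX := (hL.isCofibrant_iff _).1 hj.1
    have hj' : A.Cof j := by rw [← hL.cof_eq]; exact hj.2.1
    have hW := hj.2.2
    rw [hL.w_eq] at hW
    have := hA.isIso_pullback_fst terminalIsTerminal j (terminal.from Z)
    refine hA.hasLiftingProperty hX hj' hZ.1 ?_
    refine ((weakEquivalences V).postcomp_iff (W' := MorphismProperty.isomorphisms V) _
      (pullback.fst _ _) this).1 ?_
    rw [pullbackHom_fst]
    exact (hW Z hZ).weakEquivalence hX (hX.of_cof hj')

end IsEnrichedLBL

end Localization

/-! ### Enriched adjunctions -/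

section Adjunction

variable {V : Type u} [Category.{v} V] [MonoidalCategory V]
  {M : Type u₁} [Category.{v} M] [EnrichedOrdinaryCategory V M]
  {N : Type u₂} [Category.{v} N] [EnrichedOrdinaryCategory V N]
  {F : EnrichedFunctor V M N} {U : EnrichedFunctor V N M}

lemma eHomEquiv_underlying_map (U : EnrichedFunctor V N M) {X Y : N} (f : X ⟶ Y) :
    eHomEquiv V ((underlying U).map f) = eHomEquiv V f ≫ U.map X Y := by
  rw [underlying_map]
  exact Equiv.apply_symm_apply _ _

namespace EnrichedAdjunction

variable (adj : EnrichedAdjunction F U)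

lemma eHomWhiskerLeft_comp_homIso (X : M) {Z Z' : N} (g : Z ⟶ Z') (g' : U.obj Z ⟶ U.obj Z')
    (hg : eHomEquiv V g' = eHomEquiv V g ≫ U.map Z Z') :
    eHomWhiskerLeft V (F.obj X) g ≫ (adj.homIso X Z').hom =
      (adj.homIso X Z).hom ≫ eHomWhiskerLeft V X g' := by
  rw [eHomWhiskerLeft, eHomWhiskerLeft, assoc, assoc, adj.naturality_right, hg,
    rightUnitor_inv_naturality_assoc, MonoidalCategory.tensorHom_def, assoc,
    whisker_exchange_assoc, MonoidalCategory.whiskerLeft_comp, assoc]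

lemma eHomWhiskerRight_comp_homIso {X X' : M} (f : X ⟶ X') (f' : F.obj X ⟶ F.obj X')
    (hf : eHomEquiv V f' = eHomEquiv V f ≫ F.map X X') (Z : N) :
    eHomWhiskerRight V f' Z ≫ (adj.homIso X Z).hom =
      (adj.homIso X' Z).hom ≫ eHomWhiskerRight V f (U.obj Z) := by
  rw [eHomWhiskerRight, eHomWhiskerRight, hf, comp_whiskerRight, assoc, assoc, assoc,
    adj.naturality_left, leftUnitor_inv_naturality_assoc, whisker_exchange_assoc]

/-- The isomorphism of `V`-mapping objects of a `V`-adjunction, in terms of the underlying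
functors. -/
def underlyingHomIso (X : M) (Z : N) :
    ((underlying F).obj X ⟶[V] Z) ≅ (X ⟶[V] (underlying U).obj Z) :=
  adj.homIso X Z

lemma eHomWhiskerLeft_comp_underlyingHomIso (X : M) {Z Z' : N} (g : Z ⟶ Z') :
    eHomWhiskerLeft V ((underlying F).obj X) g ≫ (adj.underlyingHomIso X Z').hom =
      (adj.underlyingHomIso X Z).hom ≫ eHomWhiskerLeft V X ((underlying U).map g) :=
  adj.eHomWhiskerLeft_comp_homIso X g _ (eHomEquiv_underlying_map U g)

lemma eHomWhiskerRight_comp_underlyingHomIso {X X' : M} (f : X ⟶ X') (Z : N) :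
    eHomWhiskerRight V ((underlying F).map f) Z ≫ (adj.underlyingHomIso X Z).hom =
      (adj.underlyingHomIso X' Z).hom ≫ eHomWhiskerRight V f ((underlying U).obj Z) :=
  adj.eHomWhiskerRight_comp_homIso f _ (eHomEquiv_underlying_map F f) Z

/-- The adjunction between underlying categories induced by a `V`-adjunction. -/
noncomputable def underlyingAdjunction : underlying F ⊣ underlying U :=
  Adjunction.mkOfHomEquiv
    { homEquiv := fun X Z ↦
        ((eHomEquiv V).trans (Iso.homToEquiv (adj.underlyingHomIso X Z))).trans (eHomEquiv V).symm
      homEquiv_naturality_left_symm := fun {X' X Z} f g ↦ by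
        simp only [Equiv.symm_trans_apply, Equiv.symm_symm, Iso.homToEquiv_symm_apply]
        rw [Equiv.symm_apply_eq, ← eHomEquiv_whiskerRight, ← eHomEquiv_whiskerRight,
          Equiv.apply_symm_apply, assoc, assoc]
        congr 1
        rw [Iso.comp_inv_eq, assoc, adj.eHomWhiskerRight_comp_underlyingHomIso,
          Iso.inv_hom_id_assoc]
      homEquiv_naturality_right := fun {X Z Z'} f g ↦ by
        simp only [Equiv.trans_apply, Iso.homToEquiv_apply]
        rw [Equiv.symm_apply_eq, ← eHomEquiv_whiskerLeft, ← eHomEquiv_whiskerLeft,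
          Equiv.apply_symm_apply, assoc, assoc, adj.eHomWhiskerLeft_comp_underlyingHomIso] }

end EnrichedAdjunction

end Adjunction

/-! ### Recognition of Quillen pairs -/

section Quillen

variable {V : Type u} [Category.{v} V] [MonoidalCategory V]
  {M : Type u₁} [Category.{v} M] [EnrichedOrdinaryCategory V M] [HasColimits M]
  {N : Type u₂} [Category.{v} N] [EnrichedOrdinaryCategory V N] [HasColimits N]
  {F : EnrichedFunctor V M N} {U : EnrichedFunctor V N M}
  {A : LeftSemimodelStructure M} {B : LeftSemimodelStructure N}

namespace EnrichedAdjunction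

lemma cof_map (adj : EnrichedAdjunction F U) (h : Preserves U B.AFib A.AFib)
    {X Y : M} {j : X ⟶ Y} (hj : A.Cof j) :
    B.Cof ((underlying F).map j) := by
  rw [B.cof_eq_llp_aFib]
  intro E D p hp
  rw [adj.underlyingAdjunction.hasLiftingProperty_iff]
  rw [A.cof_eq_llp_aFib] at hj
  exact hj _ (h p hp)

lemma isCofibrant_obj (adj : EnrichedAdjunction F U) (h : Preserves U B.AFib A.AFib)
    {X : M} (hX : A.IsCofibrant X) :
    B.IsCofibrant ((underlying F).obj X) := by
  have := adj.underlyingAdjunction.leftAdjoint_preservesColimits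
  exact .of_initial_cof (IsInitial.isInitialObj (underlying F) _ initialIsInitial)
    (adj.cof_map h hX)

variable [HasLimits M] [HasLimits N]

/-- The right adjoint of a Quillen pair preserves fibrant objects. -/
lemma IsQuillenPair.isFibrant_obj {adj : EnrichedAdjunction F U} (h : adj.IsQuillenPair A B)
    (hA : A.IsTractable) {Z : N} (hZ : B.IsFibrant Z) : A.IsFibrant ((underlying U).obj Z) := by
  have := adj.underlyingAdjunction.rightAdjoint_preservesLimits
  have hT := IsTerminal.isTerminalObj (underlying U) _ (terminalIsTerminal (C := N))
  have : IsIso (terminal.from ((underlying U).obj (⊤_ N))) :=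
    isIso_of_isTerminal hT terminalIsTerminal _
  have hZ' := h.1 _ hZ
  rw [hA.fib_eq] at hZ'
  rw [LeftSemimodelStructure.IsFibrant, hA.fib_eq,
    Subsingleton.elim (terminal.from _) ((underlying U).map (terminal.from Z) ≫ terminal.from _)]
  exact MorphismProperty.comp_mem _ _ _ hZ' (MorphismProperty.rlp_of_isIso _ _)

variable [SymmetricCategory V] [MonoidalClosed V] [ModelCategory V]

/-- If the right adjoint preserves acyclic fibrations and fibrant objects, the left adjoint sends
acyclic cofibrations with cofibrant domain to acyclic cofibrations. On mapping objects into
fibrant objects `Z` the map `F j` induces `(j, U Z)`, which is a weak equivalence; hence `F j` lifts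
against all fibrations between fibrant objects. -/
lemma aCof_map (adj : EnrichedAdjunction F U) (hA : IsEnrichedSemimodel V A)
    (hB : IsEnrichedSemimodel V B) (hB' : B.IsTractable) (h : Preserves U B.AFib A.AFib)
    (hU : ∀ Z : N, B.IsFibrant Z → A.IsFibrant ((underlying U).obj Z)) {C D : M} {j : C ⟶ D}
    (hj : A.ACof j) : B.ACof ((underlying F).map j) := by
  set k := (underlying F).map j with hk_def
  have hC : B.IsCofibrant ((underlying F).obj C) := adj.isCofibrant_obj h hj.1
  have hk : B.Cof k := adj.cof_map h hj.2.1
  have hD : B.IsCofibrant ((underlying F).obj D) := hC.of_cof hk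
  have hkZ (Z : N) (hZ : B.IsFibrant Z) :
      (cofibrantCofibrations V).rlp (eHomWhiskerRight V k Z) := by
    have e := adj.eHomWhiskerRight_comp_underlyingHomIso j Z
    rw [← Iso.eq_comp_inv, assoc] at e
    rw [hk_def, e]
    exact MorphismProperty.comp_mem _ _ _ (MorphismProperty.rlp_of_isIso _ _)
      (MorphismProperty.comp_mem _ _ _ (hA.rlp_eHomWhiskerRight hj (hU Z hZ))
        (MorphismProperty.rlp_of_isIso _ _))
  -- `k` lifts against fibrations between fibrant objects
  have hlift {E R : N} (p : E ⟶ R) (hp : B.Fib p) (hE : B.IsFibrant E) (hR : B.IsFibrant R) :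
      HasLiftingProperty k p := by
    refine hB.hasLiftingProperty hC hk hp ?_
    have hfst : (cofibrantCofibrations V).rlp
        (pullback.fst (eHomWhiskerLeft V ((underlying F).obj C) p) (eHomWhiskerRight V k R)) :=
      MorphismProperty.pullback_fst _ _ (hkZ R hR)
    have : WeakEquivalence
        (pullback.fst (eHomWhiskerLeft V ((underlying F).obj C) p) (eHomWhiskerRight V k R)) :=
      ⟨weakEquivalence_of_rlp_cofibrantCofibrations _ hfst⟩
    have : WeakEquivalence (eHomWhiskerRight V k E) :=
      ⟨weakEquivalence_of_rlp_cofibrantCofibrations _ (hkZ E hE)⟩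
    exact (weakEquivalence_of_postcomp_of_fac (pullbackHom_fst k p)).mem
  obtain ⟨R, d, r, hd, hd', hr, -⟩ := B.factor_acyclicCof_fib (terminal.from _) hD
  have hR : B.IsFibrant R := by
    rwa [Subsingleton.elim r (terminal.from R)] at hr
  obtain ⟨E, i, p, hi, hi', hp, fac⟩ := B.factor_acyclicCof_fib (k ≫ d) hC
  have hE : B.IsFibrant E := by
    rw [LeftSemimodelStructure.IsFibrant, hB'.fib_eq] at hR ⊢
    rw [hB'.fib_eq] at hp
    rw [Subsingleton.elim (terminal.from E) (p ≫ terminal.from R)]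
    exact MorphismProperty.comp_mem _ _ _ hp hR
  have := hlift p hp hE hR
  have := B.lift_acyclicCof_fib d p hD hd hd' hp
  -- hence `k ≫ d` is a retract of the acyclic cofibration `i`
  have hkd : B.W (k ≫ d) :=
    MorphismProperty.of_retract (RetractArrow.ofLeftLiftingProperty fac) hi'
  exact ⟨hC, hk, B.W.of_postcomp k d hd' hkd⟩

/-- A `V`-adjunction between tractable left `V`-semimodel categories is a Quillen pair if and only
if its right adjoint preserves acyclic fibrations and fibrant objects. -/
lemma isQuillenPair_iff (adj : EnrichedAdjunction F U) (hA : IsEnrichedSemimodel V A)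
    (hA' : A.IsTractable) (hB : IsEnrichedSemimodel V B) (hB' : B.IsTractable) :
    adj.IsQuillenPair A B ↔
      Preserves U B.AFib A.AFib ∧ ∀ Z : N, B.IsFibrant Z → A.IsFibrant (U.obj Z) := by
  refine ⟨fun h ↦ ⟨h.2, fun Z hZ ↦ h.isFibrant_obj hA' hZ⟩, fun h ↦ ⟨fun X Y p hp ↦ ?_, h.1⟩⟩
  rw [hA'.fib_eq]
  intro C D j hj
  rw [← adj.underlyingAdjunction.hasLiftingProperty_iff]
  obtain ⟨hC, hk, hk'⟩ := adj.aCof_map hA hB hB' h.1 h.2 hj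
  exact B.lift_acyclicCof_fib _ p hC hk hk' hp

end EnrichedAdjunction

end Quillen

end EnrichedSemimodel

theorem corollary3p3
    {V : Type u} [Category.{v} V] [MonoidalCategory V] [SymmetricCategory V] [MonoidalClosed V]
    [ModelCategory V] [IsMonoidalModelCategory V]
    {M : Type u₁} [Category.{v} M] [EnrichedOrdinaryCategory V M] [HasLimits M] [HasColimits M]
    {N : Type u₂} [Category.{v} N] [EnrichedOrdinaryCategory V N] [HasLimits N] [HasColimits N]
    {N' : Type u₃} [Category.{v} N'] [EnrichedOrdinaryCategory V N'] [HasLimits N']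
    [HasColimits N']
    -- tractable left `V`-semimodel structures on `M`, `N` and `N'`
    (A : LeftSemimodelStructure M) (hA : IsEnrichedSemimodel V A) (hA' : A.IsTractable)
    (B : LeftSemimodelStructure N) (hB : IsEnrichedSemimodel V B) (hB' : B.IsTractable)
    (B' : LeftSemimodelStructure N') (hB₁ : IsEnrichedSemimodel V B') (hB₂ : B'.IsTractable)
    -- the localization of `M` at a set `S` of maps, as a tractable left `V`-semimodel category
    (S : MorphismProperty M) (hS : MorphismProperty.IsSmall.{v} S)
    (L : LeftSemimodelStructure M) (hL : IsEnrichedLBL V A S L)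
    (hL₁ : IsEnrichedSemimodel V L) (hL₂ : L.IsTractable)
    -- right `V`-adjoint functors `U : N ⟶ M` and `U' : M ⟶ N'`
    {F : EnrichedFunctor V M N} {U : EnrichedFunctor V N M} (adj : EnrichedAdjunction F U)
    {F' : EnrichedFunctor V N' M} {U' : EnrichedFunctor V M N'}
    (adj' : EnrichedAdjunction F' U') :
    (adj.IsQuillenPair L B ↔
      Preserves U B.AFib A.AFib ∧
        ∀ Z : N, B.IsFibrant Z → IsFibrantLocal V A S (U.obj Z)) ∧
    (adj'.IsQuillenPair B' L ↔
      Preserves U' A.AFib B'.AFib ∧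
        ∀ Z : M, IsFibrantLocal V A S Z → B'.IsFibrant (U'.obj Z)) := by
  rw [adj.isQuillenPair_iff hL₁ hL₂ hB hB', adj'.isQuillenPair_iff hB₁ hB₂ hL₁ hL₂, hL.aFib_eq]
  simp only [hL.isFibrant_iff hA hA' hL₁ hL₂, and_self]
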